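/- Let $F$ be a field of characteristic zero and let $(g,d,[\,,\,])$ be a differential graded Lie algebra over $F$ ($\mathbb Z$-graded, $d$ of degree $-1$, bracket of degree $0$). Let $m\subseteq g$ be a differential graded Lie subalgebra, and let a contraction of the chain complex $m$ onto the homology $H(g)$ of $g$ (with zero differential) be given: chain maps $\pi:m\to H(g)$ and $\nabla:H(g)\to m$ of degree $0$ and a linear map $h:m\to m$ of degree $1$ such that $\pi\nabla=\mathrm{id}$, $dh+hd=\nabla\pi-\mathrm{id}$, $\pi h=0$, $h\nabla=0$, $hh=0$. Suppose that the composite $m\otimes m\xrightarrow{[\,,\,]}m\xrightarrow{\pi}H(g)$ is zero. (a) If every homology class of $g$ is represented by a cycle that lies in $m$, then the bracket induced on $H(g)$ is zero, that is, $H(g)$ is abelian as a graded Lie algebra. (b) Let $S^c[sH(g)]$ be the graded symmetric coalgebra on the suspension of $H(g)$, with its unshuffle comultiplication $\Delta$ and zero differential. The data determine a solution $\tau$ of the master equation in $\mathrm{Hom}(S^c[sH(g)],g)$: there is exactly one linear map $\tau:S^c[sH(g)]\to g$ of degree $-1$ with $\tau(1)=0$ and $$d\tau=\tfrac12[\tau,\tau],$$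 where $[\tau,\tau]$ is the cup bracket $[\,,\,]\circ(\tau\otimes\tau)\circ\Delta$, such that (i) $\pi\tau$ is the universal twisting cochain $S^c[sH(g)]\to H(g)$ of the abelian Lie algebra structure on $H(g)$, that is, $sx\mapsto x$ on $sH(g)$ and zero on all components of tensor degree $\neq1$; (ii) the values of $\tau$ lie in $m$; (iii) $h\tau=0$. -/

import Mathlib

open scoped TensorProduct

noncomputable section

namespace HPT

variable {F : Type*} [Field F]

/-! ### Graded vector spaces -/

/-- A `ℤ`-grading of the `F`-vector space `V`, written internally: `V` is the direct sum of the
subspaces `deg n`. -/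
structure Grading (F : Type*) [Field F] (V : Type*) [AddCommGroup V] [Module F V] where
  /-- the homogeneous elements of degree `n` -/
  deg : ℤ → Submodule F V
  internal : DirectSum.IsInternal deg

section Grading

variable {V : Type*} [AddCommGroup V] [Module F V]

instance (G : Grading F V) : DirectSum.Decomposition G.deg :=
  G.internal.chooseDecomposition

/-- The projection onto the homogeneous component of degree `n`. -/
def Grading.proj (G : Grading F V) (n : ℤ) : V →ₗ[F] V :=
  (G.deg n).subtype ∘ₗ DirectSum.component F ℤ (fun i => G.deg i) n ∘ₗ
    (DirectSum.decomposeLinearEquiv G.deg).toLinearMap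

theorem Grading.proj_apply (G : Grading F V) (n : ℤ) (x : V) :
    G.proj n x = (DirectSum.decompose G.deg x n : V) := rfl

theorem Grading.proj_mem (G : Grading F V) (n : ℤ) (x : V) : G.proj n x ∈ G.deg n :=
  (DirectSum.decompose G.deg x n).2

theorem Grading.proj_same (G : Grading F V) {n : ℤ} {x : V} (hx : x ∈ G.deg n) :
    G.proj n x = x :=
  DirectSum.decompose_of_mem_same _ hx

theorem Grading.proj_ne (G : Grading F V) {n m : ℤ} (h : n ≠ m) {x : V} (hx : x ∈ G.deg m) :
    G.proj n x = 0 :=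
  DirectSum.decompose_of_mem_ne _ hx (Ne.symm h)

theorem Grading.exists_sum (G : Grading F V) (x : V) :
    ∃ s : Finset ℤ, x = ∑ n ∈ s, G.proj n x := by
  classical
  exact ⟨_, (DirectSum.sum_support_decompose G.deg x).symm⟩

theorem Grading.hom_induction (G : Grading F V) {p : V → Prop} (h0 : p 0)
    (hadd : ∀ x y, p x → p y → p (x + y)) (hom : ∀ n, ∀ x ∈ G.deg n, p x) (x : V) : p x := by
  obtain ⟨s, hs⟩ := G.exists_sum x
  rw [hs]
  exact Finset.sum_induction _ p hadd h0 fun n _ => hom n _ (G.proj_mem n x)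

theorem isInternal_of_proj (A : ℤ → Submodule F V) (P : ℤ → V →ₗ[F] V)
    (h1 : ∀ n, ∀ x ∈ A n, P n x = x) (h2 : ∀ n m, n ≠ m → ∀ x ∈ A m, P n x = 0)
    (h3 : ∀ x, x ∈ ⨆ n, A n) : DirectSum.IsInternal A := by
  refine DirectSum.isInternal_submodule_of_iSupIndep_of_iSup_eq_top ?_
    (eq_top_iff.2 fun x _ => h3 x)
  rw [iSupIndep_def]
  intro i
  rw [Submodule.disjoint_def]
  intro x hx hx'
  have hle : (⨆ j, ⨆ (_ : j ≠ i), A j) ≤ LinearMap.ker (P i) :=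
    iSup₂_le fun j hj y hy => h2 i j (Ne.symm hj) y hy
  rw [← h1 i x hx]
  exact hle hx'

/-- The grading of a subspace that contains the homogeneous components of its elements. -/
def Grading.restrict (G : Grading F V) (S : Submodule F V)
    (hS : ∀ n, ∀ x ∈ S, G.proj n x ∈ S) : Grading F S where
  deg n := (G.deg n).comap S.subtype
  internal := by
    refine isInternal_of_proj _ (fun n => (G.proj n).restrict (hS n)) ?_ ?_ ?_
    · intro n x hx
      exact Subtype.ext (G.proj_same hx)
    · intro n m h x hx
      exact Subtype.ext (G.proj_ne h hx)
    · intro x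
      obtain ⟨s, hs⟩ := G.exists_sum (x : V)
      have : x = ∑ n ∈ s, (G.proj n).restrict (hS n) x := by
        apply Subtype.ext
        rw [AddSubmonoidClass.coe_finsetSum]
        exact hs
      rw [this]
      refine Submodule.sum_mem _ fun n _ => Submodule.mem_iSup_of_mem n ?_
      exact G.proj_mem n x

/-- The suspension `sV`: the same vector space, an element of degree `n - 1` of `V` having
degree `n` in `sV`.  The maps `s` and `s⁻¹` are the identity of the underlying vector space. -/
def Grading.susp (G : Grading F V) : Grading F V where
  deg n := G.deg (n - 1)
  internal := by
    refine isInternal_of_proj _ (fun n => G.proj (n - 1)) (fun n x hx => G.proj_same hx)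
      (fun n m h x hx => G.proj_ne (by lia) hx) fun x => ?_
    obtain ⟨s, hs⟩ := G.exists_sum x
    rw [hs]
    refine Submodule.sum_mem _ fun n _ => Submodule.mem_iSup_of_mem (n + 1) ?_
    simpa using G.proj_mem n x

end Grading

/-! ### Chain complexes, homology, contractions -/

/-- A chain complex over `F`: a graded vector space with a differential of degree `-1`. -/
structure ChainCpx (F : Type*) [Field F] (V : Type*) [AddCommGroup V] [Module F V]
    extends Grading F V where
  /-- the differential -/
  d : V →ₗ[F] V
  d_mem : ∀ n, ∀ x ∈ deg n, d x ∈ deg (n - 1)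
  d_d : ∀ x, d (d x) = 0

namespace ChainCpx

variable {V : Type*} [AddCommGroup V] [Module F V]

theorem proj_d (K : ChainCpx F V) (n : ℤ) (x : V) :
    K.proj (n - 1) (K.d x) = K.d (K.proj n x) := by
  induction x using K.toGrading.hom_induction with
  | h0 => simp
  | hadd x y hx hy => simp only [map_add, hx, hy]
  | hom m x hx =>
    by_cases h : n = m
    · subst h
      rw [K.proj_same hx, K.proj_same (K.d_mem _ _ hx)]
    · rw [K.proj_ne h hx, K.proj_ne (by lia) (K.d_mem _ _ hx), map_zero]

theorem proj_cycle (K : ChainCpx F V) (n : ℤ) (x : V) (hx : x ∈ LinearMap.ker K.d) :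
    K.proj n x ∈ LinearMap.ker K.d := by
  rw [LinearMap.mem_ker] at hx ⊢
  rw [← K.proj_d, hx, map_zero]

/-- The boundaries, as a subspace of the cycles. -/
def boundaries (K : ChainCpx F V) : Submodule F (LinearMap.ker K.d) :=
  (LinearMap.range K.d).comap (LinearMap.ker K.d).subtype

/-- The homology `H(V) = Ker d / Im d`. -/
abbrev Homology (K : ChainCpx F V) : Type _ := LinearMap.ker K.d ⧸ K.boundaries

/-- The homology class of a cycle. -/
abbrev cls (K : ChainCpx F V) : LinearMap.ker K.d →ₗ[F] K.Homology := K.boundaries.mkQ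

/-- The homology `H(V)` as a chain complex: classes of cycles of degree `n` have degree `n`, and
the differential is zero. -/
def homology (K : ChainCpx F V) : ChainCpx F K.Homology where
  deg n := ((K.deg n).comap (LinearMap.ker K.d).subtype).map K.cls
  internal := by
    have hb : ∀ n, K.boundaries ≤
        K.boundaries.comap ((K.proj n).restrict (K.proj_cycle n)) := by
      rintro n x ⟨y, hy⟩
      exact ⟨K.proj (n + 1) y, by
        rw [← K.proj_d, hy, add_sub_cancel_right]; rfl⟩
    refine isInternal_of_proj _
      (fun n => Submodule.mapQ _ _ ((K.proj n).restrict (K.proj_cycle n)) (hb n)) ?_ ?_ ?_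
    · rintro n _ ⟨x, hx, rfl⟩
      exact congrArg K.cls (Subtype.ext (K.proj_same hx))
    · rintro n m h _ ⟨x, hx, rfl⟩
      have : (K.proj n).restrict (K.proj_cycle n) x = 0 := Subtype.ext (K.proj_ne h hx)
      change K.cls _ = 0
      rw [this, map_zero]
    · intro a
      obtain ⟨x, rfl⟩ := Submodule.Quotient.mk_surjective _ a
      obtain ⟨s, hs⟩ := K.exists_sum (x : V)
      have : x = ∑ n ∈ s, (K.proj n).restrict (K.proj_cycle n) x := by
        apply Subtype.ext
        rw [AddSubmonoidClass.coe_finsetSum]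
        exact hs
      change K.cls x ∈ _
      rw [this, map_sum]
      refine Submodule.sum_mem _ fun n _ => Submodule.mem_iSup_of_mem n ?_
      exact ⟨_, K.proj_mem n x, rfl⟩
  d := 0
  d_mem _ _ _ := Submodule.zero_mem _
  d_d _ := rfl

end ChainCpx

/-- A contraction of the chain complex `N` onto the chain complex `M`: chain maps `π : N → M` and
`∇ : M → N` (of degree `0`) and `h : N → N` of degree `1` with `π ∇ = id`,
`d h + h d = ∇ π - id`, `π h = 0`, `h ∇ = 0` and `h h = 0`. -/
structure Contraction {V W : Type*} [AddCommGroup V] [Module F V] [AddCommGroup W] [Module F W]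
    (M : ChainCpx F V) (N : ChainCpx F W) where
  /-- the projection `π` -/
  pr : W →ₗ[F] V
  /-- the inclusion `∇` -/
  nabla : V →ₗ[F] W
  /-- the homotopy -/
  h : W →ₗ[F] W
  pr_mem : ∀ n, ∀ x ∈ N.deg n, pr x ∈ M.deg n
  nabla_mem : ∀ n, ∀ x ∈ M.deg n, nabla x ∈ N.deg n
  h_mem : ∀ n, ∀ x ∈ N.deg n, h x ∈ N.deg (n + 1)
  pr_d : ∀ x, pr (N.d x) = M.d (pr x)
  nabla_d : ∀ x, nabla (M.d x) = N.d (nabla x)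
  pr_nabla : ∀ x, pr (nabla x) = x
  homotopy : ∀ x, N.d (h x) + h (N.d x) = nabla (pr x) - x
  pr_h : ∀ x, pr (h x) = 0
  h_nabla : ∀ x, h (nabla x) = 0
  h_h : ∀ x, h (h x) = 0

/-! ### Differential graded Lie algebras -/

/-- A differential graded Lie algebra: a chain complex with a bilinear bracket of degree `0` that
is graded skew-symmetric, satisfies the graded Jacobi identity, and of which `d` is a graded
derivation. -/
structure DGLA (F : Type*) [Field F] (g : Type*) [AddCommGroup g] [Module F g]
    extends ChainCpx F g where
  /-- the bracket -/
  br : g →ₗ[F] g →ₗ[F] g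
  br_mem : ∀ i j, ∀ x ∈ deg i, ∀ y ∈ deg j, br x y ∈ deg (i + j)
  br_skew : ∀ i j, ∀ x ∈ deg i, ∀ y ∈ deg j,
    br x y = -(((i * j).negOnePow : ℤ) • br y x)
  br_jacobi : ∀ i j, ∀ x ∈ deg i, ∀ y ∈ deg j, ∀ z,
    br x (br y z) = br (br x y) z + ((i * j).negOnePow : ℤ) • br y (br x z)
  d_br : ∀ i, ∀ x ∈ deg i, ∀ y, d (br x y) = br (d x) y + (i.negOnePow : ℤ) • br x (d y)

namespace DGLA

variable {g : Type*} [AddCommGroup g] [Module F g]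

theorem d_br_cycle (L : DGLA F g) (x y : g) (hy : L.d y = 0) :
    L.d (L.br x y) = L.br (L.d x) y := by
  induction x using L.toGrading.hom_induction with
  | h0 => simp
  | hadd x x' hx hx' => simp only [map_add, LinearMap.add_apply, hx, hx']
  | hom i x hx => rw [L.d_br i x hx, hy, map_zero, smul_zero, add_zero]

theorem cycle_br_d (L : DGLA F g) (x z : g) (hx : L.d x = 0) :
    L.br x (L.d z) ∈ LinearMap.range L.d := by
  obtain ⟨s, hs⟩ := L.exists_sum x
  rw [hs, map_sum, LinearMap.sum_apply]
  refine Submodule.sum_mem _ fun n _ => ?_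
  have h0 : L.d (L.proj n x) = 0 := L.proj_cycle n x hx
  refine ⟨(n.negOnePow : ℤ) • L.br (L.proj n x) z, ?_⟩
  rw [map_zsmul, L.d_br n _ (L.proj_mem n x), h0, map_zero, LinearMap.zero_apply, zero_add,
    smul_smul, ← Units.val_mul, Int.units_mul_self, Units.val_one, one_smul]

theorem br_cycle (L : DGLA F g) (x y : LinearMap.ker L.d) :
    L.br x y ∈ LinearMap.ker L.d := by
  have hx : L.d (x : g) = 0 := x.2
  rw [LinearMap.mem_ker, L.d_br_cycle _ _ y.2, hx, map_zero, LinearMap.zero_apply]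

/-- The bracket of cycles, followed by the passage to homology. -/
def brCycles (L : DGLA F g) :
    LinearMap.ker L.d →ₗ[F] LinearMap.ker L.d →ₗ[F] L.Homology :=
  LinearMap.mk₂ F (fun x y => L.cls ⟨L.br x y, L.br_cycle x y⟩)
    (fun x x' y => by rw [← map_add]; exact congrArg L.cls (Subtype.ext (by simp)))
    (fun c x y => by rw [← map_smul]; exact congrArg L.cls (Subtype.ext (by simp)))
    (fun x y y' => by rw [← map_add]; exact congrArg L.cls (Subtype.ext (by simp)))
    (fun c x y => by rw [← map_smul]; exact congrArg L.cls (Subtype.ext (by simp)))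

/-- The bracket induced on the homology `H(g)`: `[[x], [y]] = [[x, y]]` for cycles `x`, `y`. -/
def homologyBr (L : DGLA F g) : L.Homology →ₗ[F] L.Homology →ₗ[F] L.Homology :=
  L.boundaries.liftQ
    (LinearMap.flip (L.boundaries.liftQ L.brCycles.flip (by
      rintro y ⟨z, hz⟩
      rw [LinearMap.mem_ker]
      ext x
      refine (Submodule.Quotient.mk_eq_zero _).2 ?_
      have := L.cycle_br_d x z x.2
      rw [hz] at this
      exact this))) (by
      rintro x ⟨z, hz⟩
      rw [LinearMap.mem_ker]
      refine LinearMap.ext fun a => ?_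
      obtain ⟨y, rfl⟩ := Submodule.Quotient.mk_surjective _ a
      refine (Submodule.Quotient.mk_eq_zero _).2 ?_
      refine ⟨L.br z y, ?_⟩
      rw [L.d_br_cycle _ _ y.2, hz]
      rfl)

theorem homologyBr_cls (L : DGLA F g) (x y : LinearMap.ker L.d) :
    L.homologyBr (L.cls x) (L.cls y) = L.cls ⟨L.br x y, L.br_cycle x y⟩ := rfl

/-- A differential graded Lie subalgebra: a graded subspace closed under `d` and the bracket. -/
structure Sub (L : DGLA F g) where
  /-- the underlying subspace -/
  carrier : Submodule F g
  proj_mem : ∀ n, ∀ x ∈ carrier, L.proj n x ∈ carrier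
  d_mem : ∀ x ∈ carrier, L.d x ∈ carrier
  br_mem : ∀ x ∈ carrier, ∀ y ∈ carrier, L.br x y ∈ carrier

/-- The chain complex that underlies a differential graded Lie subalgebra. -/
def Sub.cpx {L : DGLA F g} (m : L.Sub) : ChainCpx F m.carrier where
  toGrading := L.restrict m.carrier m.proj_mem
  d := L.d.restrict m.d_mem
  d_mem n x hx := L.d_mem n x hx
  d_d x := Subtype.ext (L.d_d x)

end DGLA

/-! ### The graded symmetric coalgebra -/

section SymC

variable {V : Type*} [AddCommGroup V] [Module F V]

/-- The relations `x y = (-1)^(|x| |y|) y x` between homogeneous elements of `V`. -/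
inductive SymC.Rel (G : Grading F V) : TensorAlgebra F V → TensorAlgebra F V → Prop
  | comm {i j : ℤ} {x y : V} (hx : x ∈ G.deg i) (hy : y ∈ G.deg j) :
      SymC.Rel G (TensorAlgebra.ι F x * TensorAlgebra.ι F y)
        ((((i * j).negOnePow : ℤ) : F) • (TensorAlgebra.ι F y * TensorAlgebra.ι F x))

/-- The graded vector space `S^c[V]` that underlies the cofree graded cocommutative coalgebra on a
graded vector space `V`: it is spanned by the products `v₁ ⋯ vₙ`, `n ≥ 0`, which are
multilinear and graded symmetric in the `vᵢ`.  The multiplication is only used to write down its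
elements and its comultiplication. -/
def SymC (G : Grading F V) : Type _ := RingQuot (SymC.Rel G)

namespace SymC

variable (G : Grading F V)

instance : Ring (SymC G) := inferInstanceAs (Ring (RingQuot (SymC.Rel G)))

instance : Algebra F (SymC G) := inferInstanceAs (Algebra F (RingQuot (SymC.Rel G)))

/-- The inclusion `V → S^c[V]`, with image the elements of tensor degree one. -/
def ι : V →ₗ[F] SymC G :=
  (RingQuot.mkAlgHom F (SymC.Rel G)).toLinearMap ∘ₗ TensorAlgebra.ι F

theorem ι_comm {i j : ℤ} {x y : V} (hx : x ∈ G.deg i) (hy : y ∈ G.deg j) :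
    ι G x * ι G y = (((i * j).negOnePow : ℤ) : F) • (ι G y * ι G x) := by
  have := RingQuot.mkAlgHom_rel F (SymC.Rel.comm hx hy)
  rw [map_mul, map_smul, map_mul] at this
  exact this

/-- Algebra maps out of `SymC G` are graded commuting linear maps out of `V`. -/
def lift {A : Type*} [Semiring A] [Algebra F A] (f : V →ₗ[F] A)
    (hf : ∀ i j, ∀ x ∈ G.deg i, ∀ y ∈ G.deg j,
      f x * f y = (((i * j).negOnePow : ℤ) : F) • (f y * f x)) : SymC G →ₐ[F] A :=
  RingQuot.liftAlgHom F ⟨TensorAlgebra.lift F f, by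
    rintro _ _ ⟨hx, hy⟩
    simpa only [map_mul, map_smul, TensorAlgebra.lift_ι_apply] using hf _ _ _ hx _ hy⟩

theorem lift_ι {A : Type*} [Semiring A] [Algebra F A] (f : V →ₗ[F] A)
    (hf : ∀ i j, ∀ x ∈ G.deg i, ∀ y ∈ G.deg j,
      f x * f y = (((i * j).negOnePow : ℤ) : F) • (f y * f x)) (x : V) :
    lift G f hf (ι G x) = f x := by
  have : lift G f hf (ι G x) = TensorAlgebra.lift F f (TensorAlgebra.ι F x) :=
    RingQuot.liftAlgHom_mkAlgHom_apply _ _ _ _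
  rw [this, TensorAlgebra.lift_ι_apply]

theorem hom_ext {A : Type*} [Semiring A] [Algebra F A] {f f' : SymC G →ₐ[F] A}
    (h : ∀ x, f (ι G x) = f' (ι G x)) : f = f' := by
  refine RingQuot.ringQuot_ext' _ _ _ (TensorAlgebra.hom_ext ?_)
  ext x
  exact h x

/-- The degree-`n` part of `S^c[V]`: the span of the products `v₁ ⋯ vₖ` of homogeneous elements
with `|v₁| + ⋯ + |vₖ| = n`. -/
def deg (n : ℤ) : Submodule F (SymC G) :=
  Submodule.span F {x | ∃ l : List (Σ i, G.deg i),
    (l.map Sigma.fst).sum = n ∧ (l.map fun v => ι G (v.2 : V)).prod = x}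

theorem ι_mem {i : ℤ} {x : V} (hx : x ∈ G.deg i) : ι G x ∈ deg G i :=
  Submodule.subset_span ⟨[⟨i, x, hx⟩], by simp, by simp⟩

instance gradedMonoid : SetLike.GradedMonoid (deg G) where
  one_mem := Submodule.subset_span ⟨[], rfl, rfl⟩
  mul_mem := by
    intro i j x y hx hy
    have h := Submodule.mul_mem_mul hx hy
    rw [deg, deg, Submodule.span_mul_span] at h
    refine Submodule.span_mono ?_ h
    rintro _ ⟨_, ⟨l, hl, rfl⟩, _, ⟨l', hl', rfl⟩, rfl⟩
    exact ⟨l ++ l', by simp [hl, hl'], by simp⟩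

/-- The inclusion of `V` into the direct sum of the homogeneous parts of `S^c[V]`. -/
def decomposeAux : V →ₗ[F] DirectSum ℤ fun i => deg G i :=
  DirectSum.toModule F ℤ _ (fun i => DirectSum.lof F ℤ (fun i => deg G i) i ∘ₗ
    (ι G).restrict fun _ hx => ι_mem G hx) ∘ₗ
    (DirectSum.decomposeLinearEquiv G.deg).toLinearMap

theorem decomposeAux_of_mem {i : ℤ} {x : V} (hx : x ∈ G.deg i) :
    decomposeAux G x = DirectSum.of (fun i => deg G i) i ⟨ι G x, ι_mem G hx⟩ := by
  simp only [decomposeAux, LinearMap.comp_apply, LinearEquiv.coe_coe,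
    DirectSum.decomposeLinearEquiv_apply, DirectSum.decompose_of_mem _ hx]
  rw [← DirectSum.lof_eq_of F, DirectSum.toModule_lof]
  rfl

theorem decomposeAux_comm (i j : ℤ) (x : V) (hx : x ∈ G.deg i) (y : V) (hy : y ∈ G.deg j) :
    decomposeAux G x * decomposeAux G y =
      (((i * j).negOnePow : ℤ) : F) • (decomposeAux G y * decomposeAux G x) := by
  rw [decomposeAux_of_mem G hx, decomposeAux_of_mem G hy, DirectSum.of_mul_of,
    DirectSum.of_mul_of, ← DirectSum.lof_eq_of F, ← DirectSum.lof_eq_of F, ← map_smul,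
    DirectSum.lof_eq_of, DirectSum.lof_eq_of]
  refine DirectSum.of_eq_of_gradedMonoid_eq (Sigma.subtype_ext (add_comm i j) ?_)
  exact ι_comm G hx hy

instance gradedAlgebra : GradedAlgebra (deg G) :=
  GradedAlgebra.ofAlgHom (deg G) (lift G (decomposeAux G) (decomposeAux_comm G))
    (by
      refine hom_ext G fun x => ?_
      rw [AlgHom.comp_apply, lift_ι, AlgHom.id_apply]
      induction x using G.hom_induction with
      | h0 => simp
      | hadd x y hx hy => simp only [map_add, hx, hy]
      | hom i x hx => rw [decomposeAux_of_mem G hx, DirectSum.coeAlgHom_of])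
    (by
      rintro i ⟨x, hx⟩
      induction hx using Submodule.span_induction with
      | mem x h =>
        obtain ⟨l, rfl, rfl⟩ := h
        induction l with
        | nil => exact map_one _
        | cons v l ih =>
          simp only [List.map_cons, List.prod_cons, map_mul, lift_ι]
          rw [ih, decomposeAux_of_mem G v.2.2,
            DirectSum.of_mul_of]
          refine DirectSum.of_eq_of_gradedMonoid_eq (Sigma.subtype_ext ?_ rfl)
          rfl
      | zero =>
        rw [map_zero]
        exact (map_zero (DirectSum.of (fun i => deg G i) i)).symm
      | add x y hx hy hx' hy' =>
        rw [map_add, hx', hy', ← map_add]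
        rfl
      | smul c x hx hx' =>
        rw [map_smul, hx', ← DirectSum.lof_eq_of F, ← map_smul]
        rfl)

theorem swap_tmul {i j : ℤ} {x y : V} (hx : x ∈ G.deg i) (hy : y ∈ G.deg j) :
    (GradedTensorProduct.tmul F 1 (ι G x) * GradedTensorProduct.tmul F (ι G y) 1 :
      (deg G) ᵍ⊗[F] (deg G)) =
      (((i * j).negOnePow : ℤ) : F) • GradedTensorProduct.tmul F (ι G y) (ι G x) := by
  have h := GradedTensorProduct.tmul_coe_mul_coe_tmul (R := F) (deg G) (deg G) 1
    ⟨ι G x, ι_mem G hx⟩ ⟨ι G y, ι_mem G hy⟩ 1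
  simp only [one_mul, mul_one] at h
  rw [h, Units.smul_def, Int.cast_smul_eq_zsmul]
  rfl

theorem primitive_comm (i j : ℤ) (x : V) (hx : x ∈ G.deg i) (y : V) (hy : y ∈ G.deg j) :
    ((GradedTensorProduct.includeLeft (deg G) (deg G)).toLinearMap ∘ₗ ι G +
      (GradedTensorProduct.includeRight (deg G) (deg G)).toLinearMap ∘ₗ ι G) x *
    ((GradedTensorProduct.includeLeft (deg G) (deg G)).toLinearMap ∘ₗ ι G +
      (GradedTensorProduct.includeRight (deg G) (deg G)).toLinearMap ∘ₗ ι G) y =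
    (((i * j).negOnePow : ℤ) : F) •
    (((GradedTensorProduct.includeLeft (deg G) (deg G)).toLinearMap ∘ₗ ι G +
      (GradedTensorProduct.includeRight (deg G) (deg G)).toLinearMap ∘ₗ ι G) y *
    ((GradedTensorProduct.includeLeft (deg G) (deg G)).toLinearMap ∘ₗ ι G +
      (GradedTensorProduct.includeRight (deg G) (deg G)).toLinearMap ∘ₗ ι G) x) := by
  have hs : (((i * j).negOnePow : ℤ) : F) * (((j * i).negOnePow : ℤ) : F) = 1 := by
    rw [mul_comm j i, ← Int.cast_mul, ← Units.val_mul, Int.units_mul_self, Units.val_one,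
      Int.cast_one]
  have hL := congrArg (GradedTensorProduct.includeLeft (deg G) (deg G)) (ι_comm G hx hy)
  have hR := congrArg (GradedTensorProduct.includeRight (deg G) (deg G)) (ι_comm G hx hy)
  rw [map_mul, map_smul, map_mul] at hL hR
  have h1 := swap_tmul G hx hy
  have h2 := swap_tmul G hy hx
  have h3 := GradedTensorProduct.tmul_one_mul_one_tmul (R := F) (deg G) (deg G) (ι G x) (ι G y)
  have h4 := GradedTensorProduct.tmul_one_mul_one_tmul (R := F) (deg G) (deg G) (ι G y) (ι G x)
  simp only [LinearMap.add_apply, LinearMap.comp_apply, AlgHom.toLinearMap_apply, add_mul, mul_add,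
    smul_add, hL, hR]
  simp only [GradedTensorProduct.includeLeft_apply, GradedTensorProduct.includeRight_apply]
  rw [h1, h2, h3, h4, smul_smul, hs, one_smul]
  abel

/-- The comultiplication `Δ : S^c[V] → S^c[V] ⊗ S^c[V]`.  It is multiplicative for the product
`(a ⊗ b) (a' ⊗ b') = (-1)^(|b| |a'|) a a' ⊗ b b'` and has `Δ v = v ⊗ 1 + 1 ⊗ v` for `v ∈ V`, so
that `Δ (v₁ ⋯ vₙ)` is the sum over all unshuffles `σ` of the terms
`± v_σ(1) ⋯ v_σ(i) ⊗ v_σ(i+1) ⋯ v_σ(n)` with their Koszul signs. -/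
def comul : SymC G →ₗ[F] SymC G ⊗[F] SymC G :=
  (GradedTensorProduct.of F (deg G) (deg G)).symm.toLinearMap ∘ₗ
    (lift G ((GradedTensorProduct.includeLeft (deg G) (deg G)).toLinearMap ∘ₗ ι G +
      (GradedTensorProduct.includeRight (deg G) (deg G)).toLinearMap ∘ₗ ι G)
      (primitive_comm G)).toLinearMap

theorem comul_ι (x : V) : comul G (ι G x) = ι G x ⊗ₜ 1 + 1 ⊗ₜ ι G x := by
  simp only [comul, LinearMap.comp_apply, AlgHom.toLinearMap_apply, lift_ι]
  rfl

/-- The projection `S^c[V] → V` onto tensor degree one: it is the identity on `V` and kills all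
products of `n ≠ 1` elements of `V`. -/
def toV : SymC G →ₗ[F] V :=
  letI : Module Fᵐᵒᵖ V := Module.compHom _ ((RingHom.id F).fromOpposite mul_comm)
  haveI : IsCentralScalar F V := ⟨fun _ _ => rfl⟩
  (TrivSqZeroExt.sndHom F V) ∘ₗ
    (lift G (TrivSqZeroExt.inrHom F V) (by
      intro i j x _ y _
      simp)).toLinearMap

theorem toV_one : toV G 1 = 0 := by
  let _ : Module Fᵐᵒᵖ V := Module.compHom _ ((RingHom.id F).fromOpposite mul_comm)
  have _ : IsCentralScalar F V := ⟨fun _ _ => rfl⟩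
  change TrivSqZeroExt.snd (lift G (TrivSqZeroExt.inrHom F V) _ 1) = 0
  rw [map_one, TrivSqZeroExt.snd_one]

theorem toV_ι (x : V) : toV G (ι G x) = x := by
  simp [toV, lift_ι]

theorem toV_mul (x y : V) (s : SymC G) : toV G (ι G x * ι G y * s) = 0 := by
  simp [toV, lift_ι]

/-- The operator `x ↦ (-1)^(q |x|) x` on `S^c[V]`. -/
def koszul (q : ℤ) : SymC G →ₗ[F] SymC G :=
  DirectSum.toModule F ℤ _ (fun n => ((q * n).negOnePow : ℤ) • (deg G n).subtype) ∘ₗ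
    (DirectSum.decomposeLinearEquiv (deg G)).toLinearMap

theorem koszul_of_mem (q n : ℤ) {x : SymC G} (hx : x ∈ deg G n) :
    koszul G q x = ((q * n).negOnePow : ℤ) • x := by
  simp only [koszul, LinearMap.comp_apply, LinearEquiv.coe_coe,
    DirectSum.decomposeLinearEquiv_apply, DirectSum.decompose_of_mem _ hx]
  rw [← DirectSum.lof_eq_of F, DirectSum.toModule_lof]
  rfl

end SymC

end SymC

/-! ### The differential graded Lie algebra `Hom(C, g)` and twisting cochains -/

section Twisting

variable {V : Type*} [AddCommGroup V] [Module F V] {g : Type*} [AddCommGroup g] [Module F g]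

/-- The differential `D a = d a - (-1)^q a d_C` of `a ∈ Hom(C, g)` of degree `q`, for `C = S^c[V]`
with codifferential `dC`. -/
def homDiff {G : Grading F V} (dC : SymC G →ₗ[F] SymC G) (L : DGLA F g) (q : ℤ)
    (a : SymC G →ₗ[F] g) : SymC G →ₗ[F] g :=
  L.d ∘ₗ a - (q.negOnePow : ℤ) • (a ∘ₗ dC)

/-- The cup bracket `[a, b]` in `Hom(C, g)`, `C = S^c[V]`, for `b` of degree `q`: the composite of
`Δ : C → C ⊗ C`, of `a ⊗ b : C ⊗ C → g ⊗ g` and of the bracket of `g`, where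
`(a ⊗ b) (x ⊗ y) = (-1)^(q |x|) a x ⊗ b y` by the Koszul rule. -/
def cupBr {G : Grading F V} (L : DGLA F g) (q : ℤ) (a b : SymC G →ₗ[F] g) : SymC G →ₗ[F] g :=
  TensorProduct.lift L.br ∘ₗ TensorProduct.map (a ∘ₗ SymC.koszul G q) b ∘ₗ SymC.comul G

/-- A Lie algebra twisting cochain `t : C → g` on `C = S^c[V]` with codifferential `dC`: a map of
degree `-1` that vanishes on the image `F · 1` of the coaugmentation and solves the master equation
`D t = (1/2) [t, t]`. -/
structure IsLieTwistingCochain {G : Grading F V} (dC : SymC G →ₗ[F] SymC G) (L : DGLA F g)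
    (t : SymC G →ₗ[F] g) : Prop where
  degree : ∀ n, ∀ x ∈ SymC.deg G n, t x ∈ L.deg (n - 1)
  coaug : t 1 = 0
  master : homDiff dC L (-1) t = (2⁻¹ : F) • cupBr L (-1) t t

/-- The universal twisting cochain `S^c[sV] → V` for a graded Lie algebra structure on `V`:
`s x ↦ x`, and zero on all tensor degrees other than one. -/
def univTwisting (G : Grading F V) : SymC G.susp →ₗ[F] V := SymC.toV G.susp

end Twisting

end HPT

end

/-! For (a), let x, y be cycles in m. Then [x,y] is a cycle killed by π, so dh + hd = ∇π - id gives
[x,y] = -dh[x,y], a boundary. For (b), work inside m and let t be the universal twisting cochain.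
Evaluating the homotopy identity on values of τ shows that a solution with πτ = t and hτ = 0
satisfies τ = ∇t - (1/2)h[τ,τ] (`perturb_eq_of_twisting`). As τ(1) = 0, the value of [τ,τ] on a
product of n elements only involves τ on shorter products (`cupBr_congr`). So the equation is a
recursion on tensor degree, with exactly one solution vanishing at 1 (`exists_perturb_fixed`,
`perturb_fixed_unique`). Conversely, the fixed point has the right πτ and hτ by the identities of a
contraction. Its defect e = dτ - (1/2)[τ,τ] satisfies e = h[e,τ], because π[ , ] = 0, d[τ,τ] =
2[dτ,τ] and [[τ,τ],τ] = 0. The same recursion forces e = 0 (`master_of_perturb_eq`). -/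

open scoped TensorProduct

noncomputable section

namespace HPT

variable {F : Type*} [Field F] {V : Type*} [AddCommGroup V] [Module F V]
  {g : Type*} [AddCommGroup g] [Module F g]

/-! ### Words in the symmetric coalgebra and the filtration by word length -/

namespace SymC

variable (G : Grading F V)

/-- The product in `S^c[V]` of a list of homogeneous elements of `V`. -/
def word (l : List (Σ i, G.deg i)) : SymC G := (l.map fun v => ι G (v.2 : V)).prod

/-- The degree of a list of homogeneous elements. -/
def wordDeg (l : List (Σ i, G.deg i)) : ℤ := (l.map Sigma.fst).sum

theorem word_nil : word G [] = 1 := rfl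

theorem word_cons (v : Σ i, G.deg i) (l : List (Σ i, G.deg i)) :
    word G (v :: l) = ι G (v.2 : V) * word G l := rfl

theorem wordDeg_cons (v : Σ i, G.deg i) (l : List (Σ i, G.deg i)) :
    wordDeg G (v :: l) = v.1 + wordDeg G l := rfl

theorem word_mem (l : List (Σ i, G.deg i)) : word G l ∈ deg G (wordDeg G l) :=
  Submodule.subset_span ⟨l, rfl, rfl⟩

theorem span_range_word : Submodule.span F (Set.range (word G)) = ⊤ := by
  classical
  refine eq_top_iff.2 fun x _ => ?_
  rw [← DirectSum.sum_support_decompose (deg G) x]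
  refine Submodule.sum_mem _ fun n _ => ?_
  refine Submodule.span_mono ?_ (DirectSum.decompose (deg G) x n).2
  rintro _ ⟨l, -, rfl⟩
  exact ⟨l, rfl⟩

variable {G}

theorem ext_word {M : Type*} [AddCommMonoid M] [Module F M] {f f' : SymC G →ₗ[F] M}
    (h : ∀ l, f (word G l) = f' (word G l)) : f = f' :=
  LinearMap.ext_on_range (span_range_word G) h

theorem deg_induction {M : Type*} [AddCommMonoid M] [Module F M] {f : SymC G →ₗ[F] M}
    {n : ℤ} {S : Submodule F M} (h : ∀ l, wordDeg G l = n → f (word G l) ∈ S) {x : SymC G}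
    (hx : x ∈ deg G n) : f x ∈ S := by
  have : deg G n ≤ S.comap f := by
    refine Submodule.span_le.2 ?_
    rintro _ ⟨l, hl, rfl⟩
    exact h l hl
  exact this hx

theorem exists_length_bound (x : SymC G) :
    ∃ n, x ∈ Submodule.span F (word G '' {l | l.length < n}) := by
  have mono : ∀ {a b : ℕ}, a ≤ b → Submodule.span F (word G '' {l | l.length < a}) ≤
      Submodule.span F (word G '' {l | l.length < b}) := fun h =>
    Submodule.span_mono (Set.image_mono fun l (hl : l.length < _) => lt_of_lt_of_le hl h)
  have hx : x ∈ Submodule.span F (Set.range (word G)) := by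
    rw [span_range_word]; trivial
  induction hx using Submodule.span_induction with
  | mem x h =>
    obtain ⟨l, rfl⟩ := h
    exact ⟨l.length + 1, Submodule.subset_span ⟨l, Nat.lt_succ_self _, rfl⟩⟩
  | zero => exact ⟨0, Submodule.zero_mem _⟩
  | add x y _ _ hx hy =>
    obtain ⟨a, ha⟩ := hx
    obtain ⟨b, hb⟩ := hy
    exact ⟨max a b, Submodule.add_mem _ (mono (le_max_left a b) ha) (mono (le_max_right a b) hb)⟩
  | smul c x _ hx =>
    obtain ⟨a, ha⟩ := hx
    exact ⟨a, Submodule.smul_mem _ c ha⟩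

/-- A sequence of linear maps that is stationary on the words of each length has a limit. -/
theorem exists_limit {M : Type*} [AddCommGroup M] [Module F M] (σ : ℕ → SymC G →ₗ[F] M)
    (hσ : ∀ n l, l.length < n → σ n (word G l) = σ (n + 1) (word G l)) :
    ∃ τ : SymC G →ₗ[F] M, ∀ n l, l.length < n → τ (word G l) = σ n (word G l) := by
  have h1 : ∀ n k l, l.length < n → σ (n + k) (word G l) = σ n (word G l) := by
    intro n k l hl
    induction k with
    | zero => rfl
    | succ k ih => rw [← add_assoc, ← hσ _ _ (by lia), ih]
  have h2 : ∀ n k x, x ∈ Submodule.span F (word G '' {l | l.length < n}) →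
      σ (n + k) x = σ n x := by
    intro n k x hx
    refine LinearMap.eqOn_span (f := σ (n + k)) (g := σ n) ?_ hx
    rintro _ ⟨l, hl, rfl⟩
    exact h1 n k l hl
  choose N hN using exists_length_bound (G := G)
  -- The limit is read off at an arbitrarily chosen bound `N x`; stationarity makes the value
  -- independent of that choice, which yields linearity.
  have h3 : ∀ n x, x ∈ Submodule.span F (word G '' {l | l.length < n}) →
      σ (N x) x = σ n x := fun n x hx => by
    rw [← h2 n (N x) x hx, ← h2 (N x) n x (hN x), add_comm]
  have h4 : ∀ n x, N x ≤ n → σ (N x) x = σ n x := fun n x hx => by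
    rw [← h2 (N x) (n - N x) x (hN x), Nat.add_sub_cancel' hx]
  refine ⟨{ toFun := fun x => σ (N x) x, map_add' := fun x y => ?_, map_smul' := fun c x => ?_ },
    fun n l hl => h3 n _ (Submodule.subset_span ⟨l, hl, rfl⟩)⟩
  · have h := Nat.le_add_right (N x + N y) (N (x + y))
    rw [h4 (N x + N y + N (x + y)) x (by lia), h4 (N x + N y + N (x + y)) y (by lia),
      h4 (N x + N y + N (x + y)) (x + y) (by lia), map_add]
  · rw [h4 (N x + N (c • x)) x (by lia), h4 (N x + N (c • x)) (c • x) (by lia), map_smul,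
      RingHom.id_apply]

theorem koszul_one (q : ℤ) : koszul G q 1 = 1 := by
  have h : (1 : SymC G) ∈ deg G 0 := word_mem G []
  rw [koszul_of_mem G q 0 h, mul_zero, Int.negOnePow_zero, Units.val_one, one_smul]

theorem comul_one : comul G 1 = 1 ⊗ₜ 1 := by
  simp only [comul, LinearMap.comp_apply, AlgHom.toLinearMap_apply, map_one]
  rfl

/-- The map `a ↦ a (v · )` on `Hom(S^c[V], g)`. -/
def shift (a : SymC G →ₗ[F] g) (v : V) : SymC G →ₗ[F] g := a ∘ₗ LinearMap.mulLeft F (ι G v)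

end SymC

open SymC

/-! ### The cup bracket on Hom(S^c[V], g) and its graded Lie identities -/

section Cup

variable {G : Grading F V} (L : DGLA F g)

theorem cupBr_one (q : ℤ) (a b : SymC G →ₗ[F] g) : cupBr L q a b 1 = L.br (a 1) (b 1) := by
  simp [cupBr, comul_one, koszul_one]

theorem primitive_left_mul (v : V) {n : ℤ} {x : SymC G} (hx : x ∈ deg G n) (y : SymC G) :
    (GradedTensorProduct.tmul F (ι G v) 1 * GradedTensorProduct.tmul F x y :
      deg G ᵍ⊗[F] deg G) = GradedTensorProduct.tmul F (ι G v * x) y :=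
  GradedTensorProduct.tmul_one_mul_coe_tmul (R := F) (deg G) (deg G) (ι G v) ⟨x, hx⟩ y

theorem primitive_right_mul {i n : ℤ} {v : V} (hv : v ∈ G.deg i) {x : SymC G}
    (hx : x ∈ deg G n) (y : SymC G) :
    (GradedTensorProduct.tmul F 1 (ι G v) * GradedTensorProduct.tmul F x y :
      deg G ᵍ⊗[F] deg G) =
      ((i * n).negOnePow : ℤ) • GradedTensorProduct.tmul F x (ι G v * y) := by
  have e := GradedTensorProduct.tmul_coe_mul_coe_tmul (R := F) (deg G) (deg G) 1
    ⟨ι G v, ι_mem G hv⟩ ⟨x, hx⟩ y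
  rw [one_mul] at e
  exact e

/-- The map `[ , ] ∘ (a ⊗ b)` on `S^c[V] ⊗ S^c[V]`, for `b` of degree `q`. -/
def brTensor (q : ℤ) (a b : SymC G →ₗ[F] g) : deg G ᵍ⊗[F] deg G →ₗ[F] g :=
  TensorProduct.lift L.br ∘ₗ TensorProduct.map (a ∘ₗ koszul G q) b ∘ₗ
    (GradedTensorProduct.of F (deg G) (deg G)).symm.toLinearMap

theorem brTensor_tmul (q : ℤ) (a b : SymC G →ₗ[F] g) {n : ℤ} {x : SymC G} (hx : x ∈ deg G n)
    (y : SymC G) : brTensor L q a b (GradedTensorProduct.tmul F x y) =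
      ((q * n).negOnePow : ℤ) • L.br (a x) (b y) := by
  change L.br (a (koszul G q x)) (b y) = _
  rw [koszul_of_mem G q n hx, map_zsmul, map_zsmul, LinearMap.smul_apply]

/-- In the first term v passes b, at the cost of (-1)^(qi). In the second, the Koszul sign of v
passing the left tensor factor is absorbed by the degree q + i of b(v · ). -/
theorem brTensor_primitive_mul (q i : ℤ) (a b : SymC G →ₗ[F] g) {v : V} (hv : v ∈ G.deg i)
    (t : deg G ᵍ⊗[F] deg G) :
    brTensor L q a b
      ((GradedTensorProduct.tmul F (ι G v) 1 + GradedTensorProduct.tmul F 1 (ι G v)) * t) =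
    ((q * i).negOnePow : ℤ) • brTensor L q (shift a v) b t +
      brTensor L (q + i) a (shift b v) t := by
  obtain ⟨t, rfl⟩ := (GradedTensorProduct.of F (deg G) (deg G)).surjective t
  induction t using TensorProduct.induction_on with
  | zero => simp only [map_zero, mul_zero, smul_zero, add_zero]
  | add x y hx hy =>
    simp only [map_add, mul_add, smul_add] at hx hy ⊢
    rw [hx, hy]
    abel
  | tmul x y =>
    induction x using DirectSum.Decomposition.inductionOn (deg G) with
    | zero => simp only [TensorProduct.zero_tmul, map_zero, mul_zero, smul_zero, add_zero]
    | add x x' hx hx' =>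
      simp only [TensorProduct.add_tmul, map_add, mul_add, smul_add] at hx hx' ⊢
      rw [hx, hx']
      abel
    | @homogeneous n x =>
      change brTensor L q a b (_ * GradedTensorProduct.tmul F (x : SymC G) y) =
        _ • brTensor L q (shift a v) b (GradedTensorProduct.tmul F (x : SymC G) y) +
        brTensor L (q + i) a (shift b v) (GradedTensorProduct.tmul F (x : SymC G) y)
      have hvx := SetLike.GradedMul.mul_mem (ι_mem G hv) x.2
      rw [add_mul, primitive_left_mul v x.2, primitive_right_mul hv x.2, map_add, map_zsmul,
        brTensor_tmul L _ _ _ hvx, brTensor_tmul L _ _ _ x.2, brTensor_tmul L _ _ _ x.2,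
        brTensor_tmul L _ _ _ x.2, smul_smul, smul_smul, ← Units.val_mul, ← Units.val_mul,
        ← Int.negOnePow_add, ← Int.negOnePow_add, ← mul_add, ← add_mul, add_comm i q]
      rfl

/-- Since Δ(vx) = (v ⊗ 1 + 1 ⊗ v)Δ(x), a cup bracket on a word reduces to cup brackets on a shorter
one. This recursion replaces sums over unshuffles: an identity between cup brackets follows by
induction on words from the same identity in g, which is its value at 1. -/
theorem cupBr_shift (q i : ℤ) (a b : SymC G →ₗ[F] g) {v : V} (hv : v ∈ G.deg i) (x : SymC G) :
    cupBr L q a b (ι G v * x) =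
      ((q * i).negOnePow : ℤ) • cupBr L q (shift a v) b x +
        cupBr L (q + i) a (shift b v) x := by
  have h := brTensor_primitive_mul L q i a b hv
    (GradedTensorProduct.of F (deg G) (deg G) (comul G x))
  refine Eq.trans ?_ h
  change brTensor L q a b (GradedTensorProduct.of F (deg G) (deg G) (comul G (ι G v * x))) = _
  simp only [comul, LinearMap.comp_apply, AlgHom.toLinearMap_apply, map_mul, lift_ι,
    LinearEquiv.coe_coe, LinearEquiv.apply_symm_apply]
  rfl

theorem cupBr_word_cons (q : ℤ) (a b : SymC G →ₗ[F] g) (v : Σ i, G.deg i)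
    (l : List (Σ i, G.deg i)) :
    cupBr L q a b (word G (v :: l)) =
      ((q * v.1).negOnePow : ℤ) • cupBr L q (shift a (v.2 : V)) b (word G l) +
        cupBr L (q + v.1) a (shift b (v.2 : V)) (word G l) := by
  rw [word_cons, cupBr_shift L q v.1 a b v.2.2]

theorem cupBr_add_left (q : ℤ) (a a' b : SymC G →ₗ[F] g) :
    cupBr L q (a + a') b = cupBr L q a b + cupBr L q a' b := by
  simp only [cupBr, LinearMap.add_comp, LinearMap.comp_add, TensorProduct.map_add_left]

theorem cupBr_add_right (q : ℤ) (a b b' : SymC G →ₗ[F] g) :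
    cupBr L q a (b + b') = cupBr L q a b + cupBr L q a b' := by
  simp only [cupBr, LinearMap.add_comp, LinearMap.comp_add, TensorProduct.map_add_right]

theorem cupBr_smul_left (q : ℤ) (r : F) (a b : SymC G →ₗ[F] g) :
    cupBr L q (r • a) b = r • cupBr L q a b := by
  simp only [cupBr, LinearMap.smul_comp, LinearMap.comp_smul, TensorProduct.map_smul_left]

theorem cupBr_smul_right (q : ℤ) (r : F) (a b : SymC G →ₗ[F] g) :
    cupBr L q a (r • b) = r • cupBr L q a b := by
  simp only [cupBr, LinearMap.smul_comp, LinearMap.comp_smul, TensorProduct.map_smul_right]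

theorem cupBr_sub_left (q : ℤ) (a a' b : SymC G →ₗ[F] g) :
    cupBr L q (a - a') b = cupBr L q a b - cupBr L q a' b := by
  rw [eq_sub_iff_add_eq, ← cupBr_add_left, sub_add_cancel]

theorem cupBr_sub_right (q : ℤ) (a b b' : SymC G →ₗ[F] g) :
    cupBr L q a (b - b') = cupBr L q a b - cupBr L q a b' := by
  rw [eq_sub_iff_add_eq, ← cupBr_add_right, sub_add_cancel]

theorem cupBr_zsmul_left (q n : ℤ) (a b : SymC G →ₗ[F] g) :
    cupBr L q (n • a) b = n • cupBr L q a b := by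
  rw [← Int.cast_smul_eq_zsmul F, cupBr_smul_left, Int.cast_smul_eq_zsmul]

theorem cupBr_zsmul_right (q n : ℤ) (a b : SymC G →ₗ[F] g) :
    cupBr L q a (n • b) = n • cupBr L q a b := by
  rw [← Int.cast_smul_eq_zsmul F, cupBr_smul_right, Int.cast_smul_eq_zsmul]

/-- The elements of degree `p` of `Hom(S^c[V], g)`. -/
def HasDeg (a : SymC G →ₗ[F] g) (p : ℤ) : Prop := ∀ n, ∀ x ∈ deg G n, a x ∈ L.deg (n + p)

variable {L}

theorem HasDeg.shift {a : SymC G →ₗ[F] g} {p : ℤ} (ha : HasDeg L a p) (v : Σ i, G.deg i) :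
    HasDeg L (SymC.shift a (v.2 : V)) (p + v.1) := by
  intro n x hx
  have h := ha _ _ (SetLike.GradedMul.mul_mem (ι_mem G v.2.2) hx)
  rwa [show v.1 + n + p = n + (p + v.1) by ring] at h

theorem HasDeg.apply_one {a : SymC G →ₗ[F] g} {p : ℤ} (ha : HasDeg L a p) : a 1 ∈ L.deg p := by
  have h := ha 0 1 (word_mem G [])
  rwa [zero_add] at h

theorem HasDeg.d_comp {a : SymC G →ₗ[F] g} {p : ℤ} (ha : HasDeg L a p) :
    HasDeg L (L.d ∘ₗ a) (p - 1) := by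
  intro n x hx
  rw [← add_sub_assoc]
  exact L.d_mem _ _ (ha n x hx)

theorem HasDeg.cupBr {a b : SymC G →ₗ[F] g} {p q : ℤ} (ha : HasDeg L a p) (hb : HasDeg L b q) :
    HasDeg L (cupBr L q a b) (p + q) := by
  intro n x hx
  refine deg_induction (fun l hl => ?_) hx
  subst hl
  clear hx x
  -- Removing the first letter replaces a or b by its shift and changes that degree, so maps and
  -- degrees must vary in the induction.
  induction l generalizing a b p q with
  | nil =>
    rw [word_nil, cupBr_one]
    have h := L.br_mem _ _ _ ha.apply_one _ hb.apply_one
    rwa [show wordDeg G [] + (p + q) = p + q from zero_add _]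
  | cons v l ih =>
    rw [cupBr_word_cons, wordDeg_cons]
    refine Submodule.add_mem _ (zsmul_mem ?_ _) ?_
    · have h := ih (ha.shift v) hb
      rwa [show wordDeg G l + (p + v.1 + q) = v.1 + wordDeg G l + (p + q) by ring] at h
    · have h := ih ha (hb.shift v)
      rwa [show wordDeg G l + (p + (q + v.1)) = v.1 + wordDeg G l + (p + q) by ring] at h

theorem negOnePow_mul_self (n : ℤ) : ((n.negOnePow : ℤˣ) : ℤ) * (n.negOnePow : ℤˣ) = 1 := by
  rw [← Units.val_mul, Int.units_mul_self, Units.val_one]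

theorem shift_cupBr (q : ℤ) (a b : SymC G →ₗ[F] g) (v : Σ i, G.deg i) :
    SymC.shift (cupBr L q a b) (v.2 : V) =
      ((q * v.1).negOnePow : ℤ) • cupBr L q (SymC.shift a (v.2 : V)) b +
        cupBr L (q + v.1) a (SymC.shift b (v.2 : V)) :=
  LinearMap.ext fun x => cupBr_shift L q v.1 a b v.2.2 x

/-- Cocommutativity of Δ is not needed separately: up to sign, exchanging a and b exchanges the two
terms of the recursion. -/
theorem cupBr_skew {a b : SymC G →ₗ[F] g} {p q : ℤ} (ha : HasDeg L a p) (hb : HasDeg L b q) :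
    cupBr L q a b = -(((p * q).negOnePow : ℤ) • cupBr L p b a) := by
  refine ext_word fun l => ?_
  induction l generalizing a b p q with
  | nil =>
    simpa [word_nil, cupBr_one] using L.br_skew p q _ ha.apply_one _ hb.apply_one
  | cons v l ih =>
    rw [cupBr_word_cons, ih (ha.shift v) hb, ih ha (hb.shift v), LinearMap.neg_apply,
      LinearMap.neg_apply, LinearMap.neg_apply, LinearMap.smul_apply, LinearMap.smul_apply,
      LinearMap.smul_apply, cupBr_word_cons]
    simp only [add_mul, mul_add, Int.negOnePow_add, Units.val_mul, mul_comm v.1 q]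
    have h := negOnePow_mul_self (q * v.1)
    match_scalars
    · linear_combination (-((p * q).negOnePow : ℤ)) * h
    · ring

theorem d_cupBr {a : SymC G →ₗ[F] g} {p : ℤ} (ha : HasDeg L a p) (q : ℤ) (b : SymC G →ₗ[F] g) :
    L.d ∘ₗ cupBr L q a b =
      cupBr L q (L.d ∘ₗ a) b + (p.negOnePow : ℤ) • cupBr L (q - 1) a (L.d ∘ₗ b) := by
  refine ext_word fun l => ?_
  induction l generalizing a b p q with
  | nil =>
    simpa [word_nil, cupBr_one] using L.d_br p _ ha.apply_one _
  | cons v l ih =>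
    have h1 := ih (ha.shift v) q b
    have h2 := ih ha (q + v.1) (SymC.shift b (v.2 : V))
    simp only [LinearMap.comp_apply, LinearMap.add_apply, LinearMap.smul_apply] at h1 h2 ⊢
    rw [cupBr_word_cons, cupBr_word_cons, cupBr_word_cons, map_add, map_zsmul, h1, h2,
      show q + v.1 - 1 = q - 1 + v.1 by ring]
    simp only [sub_mul, one_mul, Int.negOnePow_add, Int.negOnePow_sub, Units.val_mul]
    change _ = _ • cupBr L q (L.d ∘ₗ SymC.shift a (v.2 : V)) b (word G l) +
      cupBr L (q + v.1) (L.d ∘ₗ a) (SymC.shift b (v.2 : V)) (word G l) +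
      _ • (_ • cupBr L (q - 1) (SymC.shift a (v.2 : V)) (L.d ∘ₗ b) (word G l) +
      cupBr L (q - 1 + v.1) a (L.d ∘ₗ SymC.shift b (v.2 : V)) (word G l))
    module

/-- The recursion also stands in for coassociativity: removing a letter v gives three Jacobi
identities, with v absorbed by a, b or c. -/
theorem cupBr_jacobi {a b : SymC G →ₗ[F] g} {p q : ℤ} (ha : HasDeg L a p) (hb : HasDeg L b q)
    (r : ℤ) (c : SymC G →ₗ[F] g) :
    cupBr L (q + r) a (cupBr L r b c) =
      cupBr L r (cupBr L q a b) c + ((p * q).negOnePow : ℤ) •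
        cupBr L (p + r) b (cupBr L r a c) := by
  refine ext_word fun l => ?_
  induction l generalizing a b c p q r with
  | nil =>
    simpa [word_nil, cupBr_one] using L.br_jacobi p q _ ha.apply_one _ hb.apply_one _
  | cons v l ih =>
    have h1 := ih (ha.shift v) hb r c
    have h2 := ih ha (hb.shift v) r c
    have h3 := ih ha hb (r + v.1) (SymC.shift c (v.2 : V))
    simp only [LinearMap.add_apply, LinearMap.smul_apply, cupBr_word_cons, shift_cupBr,
      cupBr_add_left, cupBr_add_right, cupBr_zsmul_left, cupBr_zsmul_right] at h1 h2 h3 ⊢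
    rw [show q + r + v.1 = q + (r + v.1) by ring, show p + r + v.1 = p + (r + v.1) by ring] at *
    rw [show q + v.1 + r = q + (r + v.1) by ring] at h2
    rw [show p + v.1 + r = p + (r + v.1) by ring] at h1
    rw [h1, h2, h3]
    simp only [add_mul, mul_add, Int.negOnePow_add, Units.val_mul, mul_comm v.1 q]
    have h := negOnePow_mul_self (q * v.1)
    match_scalars
    · ring
    · linear_combination ((p * q).negOnePow * (r * v.1).negOnePow : ℤ) * h
    · ring
    · ring
    · ring
    · ring

/-- If a word of length below i + j is split in two, the left piece is shorter than i or the right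
piece is shorter than j. -/
theorem cupBr_vanish {i j : ℕ} (q : ℤ) {a b : SymC G →ₗ[F] g}
    (ha : ∀ l, l.length < i → a (word G l) = 0) (hb : ∀ l, l.length < j → b (word G l) = 0)
    {l : List (Σ i, G.deg i)} (hl : l.length < i + j) : cupBr L q a b (word G l) = 0 := by
  induction l generalizing a b i j q with
  | nil =>
    rw [word_nil, cupBr_one]
    rcases Nat.eq_zero_or_pos i with rfl | hi
    · have h : b 1 = 0 := hb [] (by simpa using hl)
      rw [h, map_zero]
    · have h : a 1 = 0 := ha [] hi
      rw [h, map_zero, LinearMap.zero_apply]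
  | cons v l ih =>
    rw [List.length_cons] at hl
    -- Truncation is harmless: for i = 0 the condition on a is empty and the remaining word is still
    -- shorter than j; likewise for j = 0.
    rw [cupBr_word_cons, ih (i := i - 1) (j := j) q _ hb (by lia),
      ih (i := i) (j := j - 1) _ ha _ (by lia), smul_zero, add_zero]
    · intro l hl
      exact hb (v :: l) (by rw [List.length_cons]; lia)
    · intro l hl
      exact ha (v :: l) (by rw [List.length_cons]; lia)

/-- Write [a,a] - [b,b] = [a-b,a] + [b,a-b]. Vanishing at 1 is what gains one unit of length. -/
theorem cupBr_congr {n : ℕ} (q : ℤ) {a b : SymC G →ₗ[F] g} (ha : a 1 = 0) (hb : b 1 = 0)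
    (h : ∀ l, l.length < n → a (word G l) = b (word G l)) {l : List (Σ i, G.deg i)}
    (hl : l.length < n + 1) : cupBr L q a a (word G l) = cupBr L q b b (word G l) := by
  have h0 : ∀ {c : SymC G →ₗ[F] g}, c 1 = 0 → ∀ l : List (Σ i, G.deg i), l.length < 1 →
      c (word G l) = 0 := by
    intro c hc l hl
    rw [List.length_eq_zero_iff.1 (Nat.lt_one_iff.1 hl), word_nil, hc]
  have hab : ∀ l, l.length < n → (a - b) (word G l) = 0 := fun l hl => by
    rw [LinearMap.sub_apply, h l hl, sub_self]
  have e : cupBr L q a a - cupBr L q b b = cupBr L q (a - b) a + cupBr L q b (a - b) := by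
    rw [cupBr_sub_left, cupBr_sub_right]
    abel
  rw [← sub_eq_zero, ← LinearMap.sub_apply, e, LinearMap.add_apply,
    cupBr_vanish q hab (h0 ha) hl, cupBr_vanish q (h0 hb) hab (by lia), add_zero]

end Cup

/-- For odd a, Jacobi gives 2[a,[a,a]] = [[a,a],a] and skew-symmetry gives [a,[a,a]] = -[[a,a],a].
Hence 3[[a,a],a] = 0, and 3 is invertible. -/
theorem cupBr_cupBr_self [CharZero F] {G : Grading F V} {L : DGLA F g}
    {a : SymC G →ₗ[F] g} (ha : HasDeg L a (-1)) :
    cupBr L (-1) (cupBr L (-1) a a) a = 0 := by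
  have hJ := cupBr_jacobi ha ha (-1) a
  have hS := cupBr_skew ha (ha.cupBr ha)
  norm_num [Int.negOnePow_neg, Int.negOnePow_even 2 even_two] at hJ hS
  rw [hS] at hJ
  have h : (3 : F) • cupBr L (-1) (cupBr L (-1) a a) a = 0 := by
    linear_combination (norm := module) -hJ
  exact (smul_eq_zero.1 h).resolve_left (by norm_num)

theorem d_cupBr_self {G : Grading F V} {L : DGLA F g} {a : SymC G →ₗ[F] g}
    (ha : HasDeg L a (-1)) :
    L.d ∘ₗ cupBr L (-1) a a = (2 : F) • cupBr L (-1) (L.d ∘ₗ a) a := by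
  have hS := cupBr_skew ha ha.d_comp
  have h := d_cupBr ha (-1) a
  norm_num [Int.negOnePow_neg, Int.negOnePow_even 2 even_two] at h hS
  rw [hS] at h
  rw [h]
  module

theorem univTwisting_mem (G : Grading F V) {n : ℤ} {x : SymC G.susp} (hx : x ∈ deg G.susp n) :
    univTwisting G x ∈ G.deg (n - 1) := by
  refine deg_induction (fun l hl => ?_) hx
  subst hl
  match l with
  | [] =>
    rw [word_nil, univTwisting, toV_one]
    exact Submodule.zero_mem _
  | [v] =>
    rw [word_cons, word_nil, mul_one, univTwisting, toV_ι, wordDeg_cons]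
    have h : (v.2 : V) ∈ G.deg (v.1 - 1) := v.2.2
    simpa [wordDeg] using h
  | v :: w :: l =>
    rw [word_cons, word_cons, ← mul_assoc, univTwisting, toV_mul]
    exact Submodule.zero_mem _

theorem homDiff_zero {G : Grading F V} (L : DGLA F g) (q : ℤ) (a : SymC G →ₗ[F] g) :
    homDiff 0 L q a = L.d ∘ₗ a := by
  rw [homDiff, LinearMap.comp_zero, smul_zero, sub_zero]

/-! ### The fixed-point equation and the master equation -/

section Perturbation

variable {H : ChainCpx F V} {M : DGLA F g} (c : Contraction H M.toChainCpx)

/-- The map `τ ↦ ∇ t - (1/2) h [τ, τ]`, with `t` the universal twisting cochain, whose fixed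
points are the twisting cochains `τ` with `π τ = t` and `h τ = 0`. -/
def Contraction.perturb (τ : SymC H.susp →ₗ[F] g) : SymC H.susp →ₗ[F] g :=
  c.nabla ∘ₗ univTwisting H.toGrading - (2⁻¹ : F) • (c.h ∘ₗ cupBr M (-1) τ τ)

namespace Contraction

theorem perturb_one {τ : SymC H.susp →ₗ[F] g} (hτ : τ 1 = 0) : c.perturb τ 1 = 0 := by
  simp [perturb, univTwisting, toV_one, cupBr_one, hτ]

theorem perturb_congr {σ τ : SymC H.susp →ₗ[F] g} (hσ : σ 1 = 0) (hτ : τ 1 = 0) {n : ℕ}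
    (h : ∀ l, l.length < n → σ (word H.susp l) = τ (word H.susp l))
    {l : List (Σ i, H.susp.deg i)} (hl : l.length < n + 1) :
    c.perturb σ (word H.susp l) = c.perturb τ (word H.susp l) := by
  simp only [perturb, LinearMap.sub_apply, LinearMap.smul_apply, LinearMap.comp_apply]
  rw [cupBr_congr (-1) hσ hτ h hl]

theorem hasDeg_perturb {τ : SymC H.susp →ₗ[F] g} (hτ : HasDeg M τ (-1)) :
    HasDeg M (c.perturb τ) (-1) := by
  intro n x hx
  refine Submodule.sub_mem _ (c.nabla_mem _ _ (univTwisting_mem _ hx)) (Submodule.smul_mem _ _ ?_)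
  have h := c.h_mem _ _ (hτ.cupBr hτ n x hx)
  rwa [show n + (-1 + -1) + 1 = n + -1 by ring] at h

theorem perturb_fixed_unique {σ τ : SymC H.susp →ₗ[F] g} (hσ1 : σ 1 = 0) (hτ1 : τ 1 = 0)
    (hσ : c.perturb σ = σ) (hτ : c.perturb τ = τ) : σ = τ := by
  have h : ∀ n l, l.length < n → σ (word H.susp l) = τ (word H.susp l) := by
    intro n
    induction n with
    | zero => intro l hl; exact absurd hl (Nat.not_lt_zero _)
    | succ n ih =>
      intro l hl
      have := c.perturb_congr hσ1 hτ1 ih hl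
      rwa [hσ, hτ] at this
  exact ext_word fun l => h _ l (Nat.lt_succ_self _)

/-- Each application of `perturb` fixes the values on words one letter longer, so the iterates of 0
are stationary on each word. -/
theorem exists_perturb_fixed :
    ∃ τ : SymC H.susp →ₗ[F] g, τ 1 = 0 ∧ HasDeg M τ (-1) ∧ c.perturb τ = τ := by
  let σ : ℕ → SymC H.susp →ₗ[F] g := fun n => c.perturb^[n] 0
  have hs : ∀ n, σ (n + 1) = c.perturb (σ n) := fun n => Function.iterate_succ_apply' _ _ _
  have h1 : ∀ n, σ n 1 = 0 := by
    intro n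
    induction n with
    | zero => rfl
    | succ n ih => rw [hs]; exact c.perturb_one ih
  have hd : ∀ n, HasDeg M (σ n) (-1) := by
    intro n
    induction n with
    | zero => exact fun _ _ _ => Submodule.zero_mem _
    | succ n ih => rw [hs]; exact c.hasDeg_perturb ih
  have hst : ∀ n l, l.length < n → σ n (word H.susp l) = σ (n + 1) (word H.susp l) := by
    intro n
    induction n with
    | zero => intro l hl; exact absurd hl (Nat.not_lt_zero _)
    | succ n ih =>
      intro l hl
      rw [hs n, hs (n + 1)]
      exact c.perturb_congr (h1 _) (h1 _) ih hl
  obtain ⟨τ, hτ⟩ := exists_limit σ hst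
  have hτ1 : τ 1 = 0 := (hτ 1 [] Nat.zero_lt_one).trans (h1 1)
  refine ⟨τ, hτ1, fun n x hx => ?_, ext_word fun l => ?_⟩
  · refine deg_induction (fun l hl => ?_) hx
    rw [hτ _ l (Nat.lt_succ_self _)]
    exact hd _ _ _ (hl ▸ word_mem _ l)
  -- On l, the limit may be replaced by a late iterate inside `perturb`; the next iterate again
  -- agrees with the limit.
  · rw [c.perturb_congr hτ1 (h1 (l.length + 1)) (hτ (l.length + 1)) (by lia), ← hs,
      hτ (l.length + 1 + 1) l (by lia)]

/-- With hτ = 0, the homotopy identity on τ(x) reads h(dτ(x)) = ∇t(x) - τ(x); substitute the master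
equation for dτ. -/
theorem perturb_eq_of_twisting {τ : SymC H.susp →ₗ[F] g}
    (hm : M.d ∘ₗ τ = (2⁻¹ : F) • cupBr M (-1) τ τ)
    (hp : ∀ x, c.pr (τ x) = univTwisting H.toGrading x) (hh : ∀ x, c.h (τ x) = 0) :
    c.perturb τ = τ := by
  refine LinearMap.ext fun x => ?_
  have h1 := c.homotopy (τ x)
  have h2 := LinearMap.congr_fun hm x
  simp only [LinearMap.comp_apply, LinearMap.smul_apply] at h2
  rw [hh, map_zero, zero_add, h2, map_smul, hp] at h1
  simp only [perturb, LinearMap.sub_apply, LinearMap.smul_apply, LinearMap.comp_apply]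
  rw [h1]
  abel

theorem pr_of_perturb_eq {τ : SymC H.susp →ₗ[F] g} (hτ : c.perturb τ = τ) (x : SymC H.susp) :
    c.pr (τ x) = univTwisting H.toGrading x := by
  rw [← hτ]
  simp [perturb, c.pr_nabla, c.pr_h]

theorem h_of_perturb_eq {τ : SymC H.susp →ₗ[F] g} (hτ : c.perturb τ = τ) (x : SymC H.susp) :
    c.h (τ x) = 0 := by
  rw [← hτ]
  simp [perturb, c.h_nabla, c.h_h]

/-- If `π [ , ] = 0` and `H` has zero differential, then a fixed point of `perturb` solves the
master equation: the defect `e = d τ - (1/2) [τ, τ]` satisfies `e = h [e, τ]`. -/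
theorem master_of_perturb_eq [CharZero F] (hH : H.d = 0) (hbr : ∀ x y, c.pr (M.br x y) = 0)
    {τ : SymC H.susp →ₗ[F] g} (hτ1 : τ 1 = 0) (hdeg : HasDeg M τ (-1)) (hτ : c.perturb τ = τ) :
    M.d ∘ₗ τ = (2⁻¹ : F) • cupBr M (-1) τ τ := by
  have hpr : ∀ x, c.pr (cupBr M (-1) τ τ x) = 0 := by
    have h : c.pr ∘ₗ TensorProduct.lift M.br = 0 := TensorProduct.ext' hbr
    exact fun x => LinearMap.congr_fun h _
  set e := M.d ∘ₗ τ - (2⁻¹ : F) • cupBr M (-1) τ τ with he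
  -- The two sides differ by a multiple of [[τ,τ],τ] = 0.
  have hde : cupBr M (-1) (M.d ∘ₗ τ) τ = cupBr M (-1) e τ := by
    rw [he, cupBr_sub_left, cupBr_smul_left, cupBr_cupBr_self hdeg, smul_zero, sub_zero]
  have hfix : ∀ x, e x = c.h (cupBr M (-1) e τ x) := by
    intro x
    have h1 := c.homotopy (cupBr M (-1) τ τ x)
    have h2 := LinearMap.congr_fun (d_cupBr_self hdeg) x
    rw [hde] at h2
    simp only [LinearMap.comp_apply, LinearMap.smul_apply] at h2
    rw [h2, hpr, map_zero, zero_sub, map_smul] at h1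
    -- The term d∇t = ∇dt drops out because H has zero differential.
    have h3 : M.d (τ x) = -((2⁻¹ : F) • M.d (c.h (cupBr M (-1) τ τ x))) := by
      conv_lhs => rw [← hτ]
      simp only [perturb, LinearMap.sub_apply, LinearMap.smul_apply, LinearMap.comp_apply,
        map_sub, map_smul]
      rw [← c.nabla_d, hH, LinearMap.zero_apply, map_zero, zero_sub]
    have h4 := congrArg ((2⁻¹ : F) • ·) h1
    simp only [smul_add, smul_smul, inv_mul_cancel₀ (two_ne_zero' F), one_smul, smul_neg] at h4
    simp only [he, LinearMap.sub_apply, LinearMap.smul_apply, LinearMap.comp_apply, h3]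
    simp only [he] at h4
    rw [sub_eq_iff_eq_add, neg_eq_iff_eq_neg, neg_add_rev, ← h4]
    abel
  -- As τ(1) = 0, the bracket [e,τ] on a word only sees e on shorter words, so e = h[e,τ] propagates
  -- vanishing.
  have hz : ∀ n l, l.length < n → e (word H.susp l) = 0 := by
    intro n
    induction n with
    | zero => intro l hl; exact absurd hl (Nat.not_lt_zero _)
    | succ n ih =>
      intro l hl
      rw [hfix, cupBr_vanish (j := 1) (-1) ih (fun l hl => ?_) hl, map_zero]
      rw [List.length_eq_zero_iff.1 (Nat.lt_one_iff.1 hl), word_nil, hτ1]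
  rw [← sub_eq_zero]
  exact ext_word fun l => hz _ l (Nat.lt_succ_self _)

end Contraction

end Perturbation

/-! ### Passage between m and g, and the bracket on homology -/

namespace DGLA

/-- A differential graded Lie subalgebra as a differential graded Lie algebra. -/
def Sub.toDGLA {L : DGLA F g} (m : L.Sub) : DGLA F m.carrier where
  toChainCpx := m.cpx
  br := LinearMap.mk₂ F (fun x y => ⟨L.br x y, m.br_mem x x.2 y y.2⟩)
    (fun x x' y => Subtype.ext (by simp)) (fun r x y => Subtype.ext (by simp))
    (fun x y y' => Subtype.ext (by simp)) (fun r x y => Subtype.ext (by simp))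
  br_mem i j x hx y hy := L.br_mem i j x hx y hy
  br_skew i j x hx y hy := Subtype.ext (L.br_skew i j x hx y hy)
  br_jacobi i j x hx y hy z := Subtype.ext (L.br_jacobi i j x hx y hy z)
  d_br i x hx y := Subtype.ext (L.d_br i x hx y)

theorem Sub.coe_cupBr {L : DGLA F g} (m : L.Sub) {G : Grading F V} (q : ℤ)
    (a b : SymC G →ₗ[F] m.carrier) (x : SymC G) :
    (cupBr m.toDGLA q a b x : g) =
      cupBr L q (m.carrier.subtype ∘ₗ a) (m.carrier.subtype ∘ₗ b) x := by
  have h : m.carrier.subtype ∘ₗ cupBr m.toDGLA q a b =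
      cupBr L q (m.carrier.subtype ∘ₗ a) (m.carrier.subtype ∘ₗ b) := by
    simp only [cupBr, ← LinearMap.comp_assoc]
    congr 1
    exact TensorProduct.ext' fun x y => rfl
  exact LinearMap.congr_fun h x

/-- If every homology class has a representative in `m`, and `π [ , ] = 0` on `m`, then the
bracket of homology vanishes: `[x, y] = - d h [x, y]` for cycles `x`, `y` in `m`. -/
theorem homologyBr_eq_zero (L : DGLA F g) (m : L.Sub) {H : ChainCpx F V}
    (c : Contraction H m.cpx)
    (hc : ∀ x y : m.carrier, c.pr ⟨L.br x y, m.br_mem x x.2 y y.2⟩ = 0)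
    (hm : ∀ a : L.Homology, ∃ z : LinearMap.ker L.d, (z : g) ∈ m.carrier ∧ L.cls z = a) :
    L.homologyBr = 0 := by
  refine LinearMap.ext₂ fun a b => ?_
  obtain ⟨x, hx, rfl⟩ := hm a
  obtain ⟨y, hy, rfl⟩ := hm b
  rw [homologyBr_cls]
  refine (Submodule.Quotient.mk_eq_zero _).2 ?_
  have h := c.homotopy ⟨L.br x y, m.br_mem x hx y hy⟩
  have hd : m.cpx.d ⟨L.br x y, m.br_mem x hx y hy⟩ = 0 := Subtype.ext (L.br_cycle x y)
  rw [hd, map_zero, add_zero, hc ⟨x, hx⟩ ⟨y, hy⟩, map_zero, zero_sub] at h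
  refine ⟨-(c.h ⟨L.br x y, m.br_mem x hx y hy⟩ : g), ?_⟩
  have h' : L.d (c.h ⟨L.br x y, m.br_mem x hx y hy⟩ : g) = -L.br x y := congrArg Subtype.val h
  rw [map_neg, h', neg_neg]
  rfl

end DGLA

end HPT
end

theorem theorem2 {F : Type*} [Field F] [CharZero F] {g : Type*} [AddCommGroup g] [Module F g]
    (L : HPT.DGLA F g) (m : L.Sub) (c : HPT.Contraction L.homology m.cpx)
    (hc : ∀ x y : m.carrier, c.pr ⟨L.br x y, m.br_mem x x.2 y y.2⟩ = 0) :
    ((∀ a : L.Homology, ∃ z : LinearMap.ker L.d, (z : g) ∈ m.carrier ∧ L.cls z = a) →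
      L.homologyBr = 0) ∧
    ∃! τ : HPT.SymC L.homology.susp →ₗ[F] g,
      HPT.IsLieTwistingCochain 0 L τ ∧
      ∃ hm : ∀ x, τ x ∈ m.carrier,
        (∀ x, c.pr ⟨τ x, hm x⟩ = HPT.univTwisting L.homology.toGrading x) ∧
        ∀ x, c.h ⟨τ x, hm x⟩ = 0 := by
  refine ⟨L.homologyBr_eq_zero m c hc, ?_⟩
  let c' : HPT.Contraction L.homology m.toDGLA.toChainCpx := c
  obtain ⟨τ, hτ1, hdeg, hτ⟩ := c'.exists_perturb_fixed
  -- Here `rfl` is the vanishing of the differential on homology, which holds by definition.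
  have hmaster := c'.master_of_perturb_eq rfl hc hτ1 hdeg hτ
  refine ⟨m.carrier.subtype ∘ₗ τ, ⟨⟨fun n x hx => hdeg n x hx, ?_, ?_⟩, fun x => (τ x).2,
    c'.pr_of_perturb_eq hτ, c'.h_of_perturb_eq hτ⟩, ?_⟩
  · exact congrArg Subtype.val hτ1
  · rw [HPT.homDiff_zero]
    refine LinearMap.ext fun x => ?_
    have h := congrArg Subtype.val (LinearMap.congr_fun hmaster x)
    rw [LinearMap.smul_apply, ← m.coe_cupBr]
    exact h
  · rintro σ ⟨hσ, hm, hp, hh⟩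
    -- A competitor takes values in m, so it can be compared with τ as a fixed point there.
    let σ' := σ.codRestrict m.carrier hm
    have hσ' : m.carrier.subtype ∘ₗ σ' = σ := rfl
    have hσm : m.toDGLA.d ∘ₗ σ' = (2⁻¹ : F) • HPT.cupBr m.toDGLA (-1) σ' σ' := by
      refine LinearMap.ext fun x => Subtype.ext ?_
      have h := LinearMap.congr_fun hσ.master x
      rw [HPT.homDiff_zero, ← hσ', LinearMap.smul_apply, ← m.coe_cupBr] at h
      exact h
    have := c'.perturb_fixed_unique (σ := σ') (Subtype.ext hσ.coaug) hτ1
      (c'.perturb_eq_of_twisting hσm hp hh) hτ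
    rw [← hσ', this]
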